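/- **Proposition (Surface order).** Let $d\ge 1$, $\lambda\in\mathbb R$, and write $x\sim y$ if $\|x-y\|_1=1$ in $\mathbb Z^d$. For $\omega\in\Omega=\{-1,0,1\}^{\mathbb Z^d}$, a field $\zeta\in\mathbb R^{\mathbb Z^d}$ and a finite $\Lambda\subset\mathbb Z^d$, let $$H^{\zeta}_\Lambda(\omega)=-\lambda\sum_{x\in\Lambda}\omega_x^2+\infty\sum_{x\in\Lambda,\,y\in\mathbb Z^d:\,x\sim y}\mathbf 1\{\omega_x\omega_y=-1\}-\sum_{x\in\Lambda}\zeta_x\omega_x ,$$ (with $\infty\cdot 0=0$), and let $\mu^{\zeta}_{\Lambda,\pm}$ be the probability measure on $\Omega$ that is carried by the configurations equal to $\pm1$ on $\Lambda^{\mathsf c}$ and gives each of them a mass proportional to $\exp(-H^\zeta_\Lambda(\omega))$ (the Widom–Rowlinson model with plus/minus boundary condition). For every field $\zeta$ there are probability measures $\mu^\zeta_\pm$ on $\Omega$, the infinite-volume plus and minus states, such that $\int f\,d\mu^\zeta_{\Lambda_n,\pm}\to\int f\,d\mu^\zeta_\pm$ for every $f:\Omega\to\mathbb R$ that depends on finitely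 many coordinates and every increasing sequence of finite sets $\Lambda_n$ with $\bigcup_n\Lambda_n=\mathbb Z^d$. Let $\eta=(\eta_x)_{x\in\mathbb Z^d}$ be an i.i.d. real random field such that $\eta_o$ and $-\eta_o$ have the same distribution ($o$ the origin) and $0<\mathbb E[\eta_o^2]<\infty$. For finite $\Lambda\subset\mathbb Z^d$ and $\zeta,\tilde\zeta\in\mathbb R^{\mathbb Z^d}$ let $$G_{\Lambda,\pm}(\zeta,\tilde\zeta)=\log\int\exp\Big(\sum_{x\in\Lambda}\zeta_x\omega_x\Big)\,\mu_\pm^{\mathbf 0_\Lambda\tilde\zeta_{\Lambda^{\mathsf c}}}(d\omega),\qquad F_\Lambda(\zeta)=\mathbb E\big[G_{\Lambda,+}(\zeta,\eta)-G_{\Lambda,-}(\zeta,\eta)\big],$$ where $\mathbf 0_\Lambda\tilde\zeta_{\Lambda^{\mathsf c}}$ is the field that vanishes on $\Lambda$ and equals $\tilde\zeta$ on $\Lambda^{\mathsf c}$, and let $\partial^\star\Lambda=\{j\in\Lambda^{\mathsf c}:\exists i\in\Lambda,\ j\sim i\}$. Then for every $\zeta\in\mathbb R^{\mathbb Z^d}$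 and every finite $\Lambda\subset\mathbb Z^d$, the random variable $G_{\Lambda,+}(\zeta,\eta)-G_{\Lambda,-}(\zeta,\eta)$ is integrable and $$|F_\Lambda(\zeta)|\le\big(\log 3+|\lambda|+\mathbb E[|\eta_o|]\big)\,|\partial^\star\Lambda| .$$ -/

import Mathlib

open MeasureTheory ProbabilityTheory Filter Topology

noncomputable section

namespace WidomRowlinson

/-- The vertices of the lattice `ℤ^d`. -/
abbrev Site (d : ℕ) : Type := Fin d → ℤ

/-- Spins take values in `SignType = {-1, 0, 1}`, with the discrete σ-algebra. -/
instance : MeasurableSpace SignType := ⊤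

/-- Configurations `ω ∈ {-1, 0, 1}^{ℤ^d}`, with the product σ-algebra. -/
abbrev Config (d : ℕ) : Type := Site d → SignType

/-- External fields `ζ ∈ ℝ^{ℤ^d}`. -/
abbrev ExtField (d : ℕ) : Type := Site d → ℝ

/-- Nearest neighbours of `ℤ^d`: the `1`-norm distance is one. -/
def Nbr {d : ℕ} (x y : Site d) : Prop := ∑ i, |x i - y i| = 1

/-- The outer boundary of `A`: the sites outside of `A` with a neighbour in `A`. -/
def outerBoundary {d : ℕ} (A : Set (Site d)) : Set (Site d) :=
  {j | j ∉ A ∧ ∃ i ∈ A, Nbr j i}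

/-- A configuration in `Λ`, extended by the boundary configuration `b` outside of `Λ`. -/
def glue {d : ℕ} (Λ : Finset (Site d)) (ω : Λ → SignType) (b : Config d) : Config d :=
  fun x => if h : x ∈ Λ then ω ⟨x, h⟩ else b x

open Classical in
/-- The Hamiltonian in `Λ`; it is `⊤` as soon as a site of `Λ` carries a particle next to
a particle of the opposite type (inside or outside of `Λ`). -/
def hamiltonian {d : ℕ} (ζ : ExtField d) (lam : ℝ) (Λ : Finset (Site d)) (ω : Config d) :
    EReal :=
  if ∃ x ∈ Λ, ∃ y, Nbr x y ∧ ω x * ω y = -1 then ⊤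
  else ((-lam * ∑ x ∈ Λ, (ω x : ℝ) ^ 2 - ∑ x ∈ Λ, ζ x * (ω x : ℝ) : ℝ) : EReal)

/-- The partition function in `Λ` with boundary condition `b`. -/
def partitionFunction {d : ℕ} (ζ : ExtField d) (lam : ℝ) (Λ : Finset (Site d)) (b : Config d) :
    ENNReal :=
  ∑ ω : Λ → SignType, EReal.exp (-hamiltonian ζ lam Λ (glue Λ ω b))

/-- The finite-volume Gibbs measure in `Λ` with boundary condition `b`. -/
def finiteGibbs {d : ℕ} (ζ : ExtField d) (lam : ℝ) (Λ : Finset (Site d)) (b : Config d) :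
    Measure (Config d) :=
  (partitionFunction ζ lam Λ b)⁻¹ •
    ∑ ω : Λ → SignType,
      EReal.exp (-hamiltonian ζ lam Λ (glue Λ ω b)) • Measure.dirac (glue Λ ω b)

/-- Local functions depend on finitely many coordinates only. -/
def IsLocal {d : ℕ} (f : Config d → ℝ) : Prop :=
  ∃ Δ : Finset (Site d), DependsOn f (Δ : Set (Site d))

/-- The probability measure `ν` is the local limit of the finite-volume Gibbs measures with
boundary condition `b`, along every increasing sequence of finite sets that exhausts `ℤ^d`. -/
def IsInfiniteVolumeLimit {d : ℕ} (ζ : ExtField d) (lam : ℝ) (b : Config d)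
    (ν : Measure (Config d)) : Prop :=
  IsProbabilityMeasure ν ∧
    ∀ Λ : ℕ → Finset (Site d), Monotone Λ → (∀ x, ∃ n, x ∈ Λ n) →
      ∀ f : Config d → ℝ, IsLocal f →
        Tendsto (fun n => ∫ ω, f ω ∂(finiteGibbs ζ lam (Λ n) b)) atTop (𝓝 (∫ ω, f ω ∂ν))

open Classical in
/-- The infinite-volume limit with boundary condition `b` (with the default value `0` if there
is no such limit). -/
def infiniteVolumeState {d : ℕ} (ζ : ExtField d) (lam : ℝ) (b : Config d) :
    Measure (Config d) :=
  if h : ∃ ν, IsInfiniteVolumeLimit ζ lam b ν then h.choose else 0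

/-- The infinite-volume plus state. -/
def plusState {d : ℕ} (ζ : ExtField d) (lam : ℝ) : Measure (Config d) :=
  infiniteVolumeState ζ lam (fun _ => 1)

/-- The infinite-volume minus state. -/
def minusState {d : ℕ} (ζ : ExtField d) (lam : ℝ) : Measure (Config d) :=
  infiniteVolumeState ζ lam (fun _ => -1)

/-- The field that is zero in `Λ` and equal to `ξ` outside of `Λ`. -/
def zeroOn {d : ℕ} (Λ : Finset (Site d)) (ξ : ExtField d) : ExtField d :=
  fun x => if x ∈ Λ then 0 else ξ x

/-- The order-parameter generating function for the plus state. -/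
def genPlus {d : ℕ} (lam : ℝ) (Λ : Finset (Site d)) (ζ ξ : ExtField d) : ℝ :=
  Real.log (∫ ω, Real.exp (∑ x ∈ Λ, ζ x * (ω x : ℝ)) ∂(plusState (zeroOn Λ ξ) lam))

/-- The order-parameter generating function for the minus state. -/
def genMinus {d : ℕ} (lam : ℝ) (Λ : Finset (Site d)) (ζ ξ : ExtField d) : ℝ :=
  Real.log (∫ ω, Real.exp (∑ x ∈ Λ, ζ x * (ω x : ℝ)) ∂(minusState (zeroOn Λ ξ) lam))

/-- The expected difference `F_Λ(ζ)` of the two generating functions. -/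
def genDiff {d : ℕ} {Ψ : Type*} [MeasurableSpace Ψ] (P : Measure Ψ) (η : Site d → Ψ → ℝ)
    (lam : ℝ) (Λ : Finset (Site d)) (ζ : ExtField d) : ℝ :=
  ∫ ψ, (genPlus lam Λ ζ (fun x => η x ψ) - genMinus lam Λ ζ (fun x => η x ψ)) ∂P

/-- An i.i.d. real random field on `ℤ^d` whose one-site law is symmetric and has finite and
positive variance. -/
structure IsSymmetricIIDField {d : ℕ} {Ψ : Type*} [MeasurableSpace Ψ] (P : Measure Ψ)
    (η : Site d → Ψ → ℝ) : Prop where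
  measurable : ∀ x, Measurable (η x)
  indep : iIndepFun η P
  identDistrib : ∀ x, IdentDistrib (η x) (η 0) P P
  symm : IdentDistrib (η 0) (fun ψ => -η 0 ψ) P P
  memLp : MemLp (η 0) 2 P
  pos : 0 < ∫ ψ, η 0 ψ ^ 2 ∂P

end WidomRowlinson

end

/-! ### Boltzmann weights and finite-volume expectations as finite real sums -/

noncomputable section

namespace WidomRowlinson

/-! Existence of the states: the weights satisfy the FKG lattice condition, so under plus boundary
conditions the expectation of a nonnegative increasing function decreases as the volume grows
(`integral_finiteGibbs_one_antitone`). Local functions are differences of such functions, so their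
expectations converge, and compactness supplies the limit measure. Flipping spins and field carries
this over to the minus state.

Surface bound: let `B` be the outer boundary of `Λ`. Emptying `B` creates no conflict, lowers the
log-weight by at most `|lam| + |ξ x|` per site and is at most `3 ^ B.card` to one, so it costs at
most `clearCost` on the logarithmic scale (`weightSum_le_vacant`). Once `B` is empty, the inside of
`Λ` decouples from the outside, and its law is the same for both states (`weightSum_vacant_mul`).
Hence the difference of the two generating functions is, up to `clearCost`, the difference of the
log-probabilities that `B` is empty (`abs_log_sub_log_le`). By the flip, the latter for the minus
state is the one for the plus state in the reversed field; as the field is symmetric, the two have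
equal means and cancel. What remains is the mean of `clearCost`. -/

/-- A site of `Λ` carries a particle next to a particle of the opposite type. -/
def Conflict {d : ℕ} (Λ : Finset (Site d)) (ω : Config d) : Prop :=
  ∃ x ∈ Λ, ∃ y, Nbr x y ∧ ω x * ω y = -1

open Classical in
/-- The Boltzmann weight in `Λ`, as a real number. -/
def weight {d : ℕ} (ζ : ExtField d) (lam : ℝ) (Λ : Finset (Site d)) (ω : Config d) : ℝ :=
  if Conflict Λ ω then 0 else Real.exp (∑ x ∈ Λ, (lam * (ω x : ℝ) ^ 2 + ζ x * (ω x : ℝ)))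

open Classical in
/-- The configurations that agree with `b` outside of `Λ`. -/
def configs {d : ℕ} (Λ : Finset (Site d)) (b : Config d) : Finset (Config d) :=
  Finset.univ.image fun ω : Λ → SignType => glue Λ ω b

/-- The unnormalised Gibbs expectation of `f` in `Λ` with boundary condition `b`. -/
def weightSum {d : ℕ} (ζ : ExtField d) (lam : ℝ) (Λ : Finset (Site d)) (b : Config d)
    (f : Config d → ℝ) : ℝ :=
  ∑ ω ∈ configs Λ b, weight ζ lam Λ ω * f ω

variable {d : ℕ} {ζ : ExtField d} {lam : ℝ} {Λ Δ : Finset (Site d)} {b : Config d}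
  {f g : Config d → ℝ}

theorem Nbr.symm {x y : Site d} (h : Nbr x y) : Nbr y x := by
  unfold Nbr at *
  simpa only [abs_sub_comm] using h

theorem weight_nonneg (ζ : ExtField d) (lam : ℝ) (Λ : Finset (Site d)) (ω : Config d) :
    0 ≤ weight ζ lam Λ ω := by
  unfold weight
  split_ifs
  · exact le_rfl
  · positivity

theorem exp_neg_hamiltonian (ζ : ExtField d) (lam : ℝ) (Λ : Finset (Site d)) (ω : Config d) :
    EReal.exp (-hamiltonian ζ lam Λ ω) = ENNReal.ofReal (weight ζ lam Λ ω) := by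
  unfold hamiltonian weight Conflict
  split_ifs
  · simp
  · rw [← EReal.coe_neg, EReal.exp_coe]
    congr 2
    rw [Finset.sum_add_distrib, ← Finset.mul_sum]
    ring

theorem glue_injective (Λ : Finset (Site d)) (b : Config d) :
    Function.Injective fun ω : Λ → SignType => glue Λ ω b := by
  intro ω ω' h
  funext x
  simpa [glue] using congrFun h x

theorem mem_configs {ω : Config d} : ω ∈ configs Λ b ↔ ∀ x ∉ Λ, ω x = b x := by
  classical
  simp only [configs, Finset.mem_image, Finset.mem_univ, true_and]
  constructor
  · rintro ⟨ω, rfl⟩ x hx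
    simp [glue, hx]
  · intro h
    refine ⟨fun x => ω x, funext fun x => ?_⟩
    by_cases hx : x ∈ Λ
    · simp [glue, hx]
    · simp [glue, hx, h x hx]

theorem weightSum_eq_sum_glue (ζ : ExtField d) (lam : ℝ) (Λ : Finset (Site d)) (b : Config d)
    (f : Config d → ℝ) :
    weightSum ζ lam Λ b f =
      ∑ ω : Λ → SignType, weight ζ lam Λ (glue Λ ω b) * f (glue Λ ω b) := by
  classical
  exact Finset.sum_image fun _ _ _ _ h => glue_injective Λ b h

theorem partitionFunction_eq (ζ : ExtField d) (lam : ℝ) (Λ : Finset (Site d)) (b : Config d) :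
    partitionFunction ζ lam Λ b = ENNReal.ofReal (weightSum ζ lam Λ b 1) := by
  simp only [partitionFunction, exp_neg_hamiltonian, weightSum_eq_sum_glue, Pi.one_apply, mul_one]
  rw [ENNReal.ofReal_sum_of_nonneg fun _ _ => weight_nonneg ..]

theorem weightSum_nonneg (hf : ∀ ω, 0 ≤ f ω) : 0 ≤ weightSum ζ lam Λ b f :=
  Finset.sum_nonneg fun _ _ => mul_nonneg (weight_nonneg ..) (hf _)

theorem weightSum_mono (h : ∀ ω, f ω ≤ g ω) : weightSum ζ lam Λ b f ≤ weightSum ζ lam Λ b g :=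
  Finset.sum_le_sum fun _ _ => mul_le_mul_of_nonneg_left (h _) (weight_nonneg ..)

theorem integral_finiteGibbs (ζ : ExtField d) (lam : ℝ) (Λ : Finset (Site d)) (b : Config d)
    (f : Config d → ℝ) :
    ∫ ω, f ω ∂(finiteGibbs ζ lam Λ b) = weightSum ζ lam Λ b f / weightSum ζ lam Λ b 1 := by
  rw [finiteGibbs, integral_smul_measure, partitionFunction_eq, ENNReal.toReal_inv,
    ENNReal.toReal_ofReal (weightSum_nonneg (by simp)), integral_finsetSum_measure,
    weightSum_eq_sum_glue ζ lam Λ b f, smul_eq_mul, div_eq_inv_mul]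
  · congr 1
    refine Finset.sum_congr rfl fun ω _ => ?_
    rw [integral_smul_measure, integral_dirac, exp_neg_hamiltonian,
      ENNReal.toReal_ofReal (weight_nonneg ..), smul_eq_mul]
  · intro ω _
    rw [exp_neg_hamiltonian]
    exact (integrable_dirac (by simp)).smul_measure ENNReal.ofReal_ne_top

/-- Boundary conditions without opposite spins. -/
def Compatible (b : Config d) : Prop := ∀ x y, b x * b y ≠ -1

theorem compatible_one : Compatible (fun _ => 1 : Config d) :=
  fun _ _ => show (1 : SignType) * 1 ≠ -1 by decide

theorem compatible_neg_one : Compatible (fun _ => -1 : Config d) :=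
  fun _ _ => show (-1 : SignType) * -1 ≠ -1 by decide

/-- The configuration `b` itself is conflict-free and contributes a positive term. -/
theorem weightSum_one_pos (hb : Compatible b) (ζ : ExtField d) (lam : ℝ) (Λ : Finset (Site d)) :
    0 < weightSum ζ lam Λ b 1 := by
  refine Finset.sum_pos' (fun _ _ => mul_nonneg (weight_nonneg ..) (by simp))
    ⟨b, mem_configs.2 fun _ _ => rfl, ?_⟩
  have : ¬ Conflict Λ b := fun ⟨x, _, y, _, h⟩ => hb x y h
  simp [weight, this, Real.exp_pos]

theorem isProbabilityMeasure_finiteGibbs (hb : Compatible b) (ζ : ExtField d) (lam : ℝ)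
    (Λ : Finset (Site d)) : IsProbabilityMeasure (finiteGibbs ζ lam Λ b) := by
  have h1 : partitionFunction ζ lam Λ b ≠ 0 := by
    rw [partitionFunction_eq]
    simpa using weightSum_one_pos hb ζ lam Λ
  have h2 : partitionFunction ζ lam Λ b ≠ ⊤ := by simp [partitionFunction_eq]
  constructor
  simp only [finiteGibbs, Measure.smul_apply, Measure.finsetSum_apply, measure_univ, smul_eq_mul,
    mul_one]
  exact ENNReal.inv_mul_cancel h1 h2

/-! ### Stochastic monotonicity -/

theorem SignType.inf_sup_apply_pair (F : SignType → SignType → ℝ) (a b : SignType)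
    (hF : ∀ x y, F x y = F y x) : F (a ⊓ b) (a ⊔ b) = F a b := by
  rcases le_total a b with h | h
  · simp [h]
  · simp [h, hF b a]

/-- Where the supremum is `-1`, both configurations are `-1`; where it is `1`, at least one of them
is `1`, and that one already has the conflict. -/
theorem conflict_or_of_conflict_sup {ω ω' : Config d} (h : Conflict Λ (ω ⊔ ω')) :
    Conflict Λ ω ∨ Conflict Λ ω' := by
  obtain ⟨x, hx, y, hxy, h⟩ := h
  have : ω x * ω y = -1 ∨ ω' x * ω' y = -1 := by
    revert h
    simp only [Pi.sup_apply]
    generalize ω x = p, ω y = q, ω' x = r, ω' y = s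
    revert p q r s
    decide
  exact this.imp (fun h => ⟨x, hx, y, hxy, h⟩) fun h => ⟨x, hx, y, hxy, h⟩

theorem conflict_or_of_conflict_inf {ω ω' : Config d} (h : Conflict Λ (ω ⊓ ω')) :
    Conflict Λ ω ∨ Conflict Λ ω' := by
  obtain ⟨x, hx, y, hxy, h⟩ := h
  have : ω x * ω y = -1 ∨ ω' x * ω' y = -1 := by
    revert h
    simp only [Pi.inf_apply]
    generalize ω x = p, ω y = q, ω' x = r, ω' y = s
    revert p q r s
    decide
  exact this.imp (fun h => ⟨x, hx, y, hxy, h⟩) fun h => ⟨x, hx, y, hxy, h⟩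

/-- The lattice condition of Fortuin, Kasteleyn and Ginibre. -/
theorem weight_mul_weight_le (ζ : ExtField d) (lam : ℝ) (Λ : Finset (Site d)) (ω ω' : Config d) :
    weight ζ lam Λ ω * weight ζ lam Λ ω' ≤
      weight ζ lam Λ (ω ⊓ ω') * weight ζ lam Λ (ω ⊔ ω') := by
  by_cases h : Conflict Λ ω ∨ Conflict Λ ω'
  · have : weight ζ lam Λ ω * weight ζ lam Λ ω' = 0 := by
      rcases h with h | h <;> simp [weight, h]
    rw [this]
    exact mul_nonneg (weight_nonneg ..) (weight_nonneg ..)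
  · have h1 := mt conflict_or_of_conflict_inf h
    have h2 := mt conflict_or_of_conflict_sup h
    rw [not_or] at h
    simp only [weight, h.1, h.2, h1, h2, if_false, ← Real.exp_add, ← Finset.sum_add_distrib]
    refine (congrArg _ (Finset.sum_congr rfl fun x _ => ?_)).le
    exact (SignType.inf_sup_apply_pair (fun s t => lam * (s : ℝ) ^ 2 + ζ x * s +
      (lam * (t : ℝ) ^ 2 + ζ x * t)) (ω x) (ω' x) fun s t => add_comm _ _).symm

/-- Two sites outside `Λ` both carry `1`, so every conflict involves a site of `Λ`. Thus the plus
measure in `Λ` is the one in `Δ` conditioned on being `1` on `Δ \ Λ`. -/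
theorem weight_eq_of_eq_one (h : Λ ⊆ Δ) {ω : Config d} (hω : ∀ x ∉ Λ, ω x = 1) :
    weight ζ lam Δ ω = Real.exp (∑ x ∈ Δ \ Λ, (lam + ζ x)) * weight ζ lam Λ ω := by
  have hc : Conflict Δ ω ↔ Conflict Λ ω := by
    constructor
    · rintro ⟨x, hx, y, hxy, e⟩
      by_cases hxΛ : x ∈ Λ
      · exact ⟨x, hxΛ, y, hxy, e⟩
      · by_cases hyΛ : y ∈ Λ
        · exact ⟨y, hyΛ, x, hxy.symm, by rw [mul_comm, e]⟩
        · rw [hω x hxΛ, hω y hyΛ] at e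
          exact absurd e (by decide)
    · rintro ⟨x, hx, y, hxy, e⟩
      exact ⟨x, h hx, y, hxy, e⟩
  rw [weight, weight, propext hc]
  split_ifs
  · simp
  · rw [← Real.exp_add, ← Finset.sum_sdiff h]
    congr 2
    refine Finset.sum_congr rfl fun x hx => ?_
    rw [hω x (Finset.mem_sdiff.1 hx).2]
    simp

/-- Increasing expectations under the plus boundary condition decrease with the volume. -/
theorem integral_finiteGibbs_one_antitone (hf : Monotone f) (hf0 : ∀ ω, 0 ≤ f ω) (h : Λ ⊆ Δ) :
    ∫ ω, f ω ∂(finiteGibbs ζ lam Δ (fun _ => 1)) ≤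
      ∫ ω, f ω ∂(finiteGibbs ζ lam Λ (fun _ => 1)) := by
  classical
  set c := Real.exp (∑ x ∈ Δ \ Λ, (lam + ζ x)) with hc
  have key (g : Config d → ℝ) : ∑ ω ∈ configs Λ (fun _ => 1), weight ζ lam Δ ω * g ω =
      c * weightSum ζ lam Λ (fun _ => 1) g := by
    rw [weightSum, Finset.mul_sum]
    refine Finset.sum_congr rfl fun ω hω => ?_
    rw [weight_eq_of_eq_one h (mem_configs.1 hω), mul_assoc]
  -- Holley-type comparison of the weight in `Δ` with its restriction to `configs Λ 1`. Since `1` is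
  -- the largest spin, suprema land in `configs Λ 1`, while infima stay in `configs Δ 1`.
  have four := four_functions_theorem (fun ω => weight ζ lam Δ ω * f ω)
    (fun ω => weight ζ lam Δ ω * (1 : Config d → ℝ) ω)
    (fun ω => weight ζ lam Δ ω * (1 : Config d → ℝ) ω) (fun ω => weight ζ lam Δ ω * f ω)
    (fun ω => mul_nonneg (weight_nonneg ..) (hf0 _))
    (fun ω => mul_nonneg (weight_nonneg ..) (by simp))
    (fun ω => mul_nonneg (weight_nonneg ..) (by simp))
    (fun ω => mul_nonneg (weight_nonneg ..) (hf0 _))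
    (fun ω ω' => by
      calc _ = weight ζ lam Δ ω * weight ζ lam Δ ω' * f ω := by simp; ring
        _ ≤ weight ζ lam Δ (ω ⊓ ω') * weight ζ lam Δ (ω ⊔ ω') * f (ω ⊔ ω') :=
          mul_le_mul (weight_mul_weight_le ..) (hf le_sup_left) (hf0 _)
            (mul_nonneg (weight_nonneg ..) (weight_nonneg ..))
        _ = _ := by simp; ring)
    (configs Δ fun _ => 1) (configs Λ fun _ => 1)
  have four' : weightSum ζ lam Δ (fun _ => 1) f * (c * weightSum ζ lam Λ (fun _ => 1) 1) ≤
      weightSum ζ lam Δ (fun _ => 1) 1 * (c * weightSum ζ lam Λ (fun _ => 1) f) := by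
    rw [← key, ← key]
    refine four.trans (mul_le_mul ?_ ?_ ?_ (weightSum_nonneg (by simp)))
    · refine Finset.sum_le_sum_of_subset_of_nonneg (fun ω hω => ?_) fun _ _ _ =>
        mul_nonneg (weight_nonneg ..) (by simp)
      obtain ⟨a, ha, a', ha', rfl⟩ := Finset.mem_infs.1 hω
      refine mem_configs.2 fun x hx => ?_
      simp [mem_configs.1 ha x hx, mem_configs.1 ha' x fun hx' => hx (h hx')]
    · refine Finset.sum_le_sum_of_subset_of_nonneg (fun ω hω => ?_) fun _ _ _ =>
        mul_nonneg (weight_nonneg ..) (hf0 _)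
      obtain ⟨a, ha, a', ha', rfl⟩ := Finset.mem_sups.1 hω
      refine mem_configs.2 fun x hx => ?_
      rw [Pi.sup_apply, mem_configs.1 ha' x hx]
      generalize a x = s
      revert s; decide
    · exact Finset.sum_nonneg fun _ _ => mul_nonneg (weight_nonneg ..) (hf0 _)
  have hc0 : 0 < c := Real.exp_pos _
  rw [integral_finiteGibbs, integral_finiteGibbs,
    div_le_div_iff₀ (weightSum_one_pos compatible_one ..) (weightSum_one_pos compatible_one ..)]
  refine le_of_mul_le_mul_left ?_ hc0
  linarith

/-! ### The flip symmetry -/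

theorem weight_neg (ζ : ExtField d) (lam : ℝ) (Λ : Finset (Site d)) (ω : Config d) :
    weight (-ζ) lam Λ (-ω) = weight ζ lam Λ ω := by
  have hc : Conflict Λ (-ω) ↔ Conflict Λ ω := by simp [Conflict]
  have hs (s : SignType) : ((-s : SignType) : ℝ) = -(s : ℝ) := by cases s <;> simp
  rw [weight, weight, propext hc]
  simp [hs]

theorem weightSum_neg (ζ : ExtField d) (lam : ℝ) (Λ : Finset (Site d)) (b : Config d)
    (f : Config d → ℝ) :
    weightSum (-ζ) lam Λ (-b) f = weightSum ζ lam Λ b fun ω => f (-ω) := by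
  refine Finset.sum_nbij' (fun ω => -ω) (fun ω => -ω) ?_ ?_ ?_ ?_ ?_
  · intro ω hω
    exact mem_configs.2 fun x hx => by simp [mem_configs.1 hω x hx]
  · intro ω hω
    exact mem_configs.2 fun x hx => by simp [mem_configs.1 hω x hx]
  · simp
  · simp
  · intro ω _
    simp only [neg_neg]
    rw [← weight_neg ζ, neg_neg]

theorem integral_finiteGibbs_neg (ζ : ExtField d) (lam : ℝ) (Λ : Finset (Site d)) (b : Config d)
    (f : Config d → ℝ) :
    ∫ ω, f ω ∂(finiteGibbs (-ζ) lam Λ (-b)) = ∫ ω, f (-ω) ∂(finiteGibbs ζ lam Λ b) := by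
  rw [integral_finiteGibbs, integral_finiteGibbs, weightSum_neg, weightSum_neg]
  rfl

end WidomRowlinson

end

noncomputable section

namespace WidomRowlinson

variable {d : ℕ} {ζ : ExtField d} {lam : ℝ} {Λ Δ : Finset (Site d)} {b : Config d}
  {f g : Config d → ℝ}

/-! ### Local functions -/

theorem IsLocal.exists_eq_comp_restrict (hf : IsLocal f) :
    ∃ (Δ : Finset (Site d)) (F : (Δ → SignType) → ℝ), ∀ ω, f ω = F fun x => ω x := by
  obtain ⟨Δ, hΔ⟩ := hf
  refine ⟨Δ, fun ω => f (glue Δ ω 0), fun ω => hΔ fun x hx => ?_⟩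
  simp [glue, Finset.mem_coe.1 hx]

theorem IsLocal.continuous (hf : IsLocal f) : Continuous f := by
  obtain ⟨Δ, F, hF⟩ := hf.exists_eq_comp_restrict
  rw [funext hF]
  exact (continuous_of_discreteTopology (f := F)).comp
    (continuous_pi fun x => continuous_apply (x : Site d))

theorem IsLocal.exists_abs_le (hf : IsLocal f) : ∃ M, ∀ ω, |f ω| ≤ M := by
  obtain ⟨Δ, F, hF⟩ := hf.exists_eq_comp_restrict
  obtain ⟨M, hM⟩ := (Set.finite_range fun ω => |F ω|).bddAbove
  exact ⟨M, fun ω => hF ω ▸ hM ⟨_, rfl⟩⟩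

theorem IsLocal.comp_neg (hf : IsLocal f) : IsLocal fun ω => f (-ω) := by
  obtain ⟨Δ, hΔ⟩ := hf
  exact ⟨Δ, fun ω ω' h => hΔ fun x hx => by simp [h x hx]⟩

theorem SignType.cast_le_cast {s t : SignType} (h : s ≤ t) : (s : ℝ) ≤ t := by
  cases s <;> cases t <;> first | (exfalso; revert h; decide) | norm_num

theorem SignType.cast_add_one_le_cast {s t : SignType} (h : s < t) : (s : ℝ) + 1 ≤ t := by
  cases s <;> cases t <;> first | (exfalso; revert h; decide) | norm_num

/-- A local function is a difference of increasing nonnegative functions. -/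
theorem IsLocal.exists_eq_sub_monotone (hf : IsLocal f) :
    ∃ f₁ f₂ : Config d → ℝ, Monotone f₁ ∧ Monotone f₂ ∧ (∀ ω, 0 ≤ f₁ ω) ∧ (∀ ω, 0 ≤ f₂ ω) ∧
      f = f₁ - f₂ := by
  obtain ⟨M, hM⟩ := hf.exists_abs_le
  obtain ⟨Δ, hΔ⟩ := hf
  have hM0 : 0 ≤ M := (abs_nonneg _).trans (hM 0)
  set h : Config d → ℝ := fun ω => ∑ x ∈ Δ, ((ω x : ℝ) + 1) with hh
  have hmono : Monotone h := fun ω ω' hω =>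
    Finset.sum_le_sum fun x _ => by linarith [SignType.cast_le_cast (hω x)]
  have hpos (ω : Config d) : 0 ≤ h ω := Finset.sum_nonneg fun x _ => by
    have := SignType.cast_le_cast (show -1 ≤ ω x by generalize ω x = s; revert s; decide)
    simp at this
    linarith
  -- A strict increase of `ω` on `Δ` raises `h` by at least `1`, so `2 * M * h` outweighs any drop
  -- of `f`, which is at most `2 * M`. The extra `M` gives nonnegativity.
  refine ⟨fun ω => f ω + M + 2 * M * h ω, fun ω => M + 2 * M * h ω, fun ω ω' hω => ?_,
    fun ω ω' hω => ?_, fun ω => ?_, fun ω => ?_, ?_⟩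
  · by_cases he : ∀ x ∈ Δ, ω x = ω' x
    · have h1 : f ω = f ω' := hΔ fun x hx => he x hx
      have h2 : h ω = h ω' := Finset.sum_congr rfl fun x hx => by rw [he x hx]
      simp only [h1, h2, le_refl]
    · push Not at he
      obtain ⟨x, hx, hne⟩ := he
      have h1 : h ω + 1 ≤ h ω' := by
        simp only [hh]
        rw [← Finset.add_sum_erase _ _ hx, ← Finset.add_sum_erase (a := x) _ _ hx]
        have := SignType.cast_add_one_le_cast (lt_of_le_of_ne (hω x) hne)
        have : ∑ y ∈ Δ.erase x, ((ω y : ℝ) + 1) ≤ ∑ y ∈ Δ.erase x, ((ω' y : ℝ) + 1) :=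
          Finset.sum_le_sum fun y _ => by linarith [SignType.cast_le_cast (hω y)]
        linarith
      have h2 := abs_le.1 (hM ω)
      have h3 := abs_le.1 (hM ω')
      have := mul_le_mul_of_nonneg_left h1 (by positivity : 0 ≤ 2 * M)
      dsimp only
      linarith
  · have := mul_le_mul_of_nonneg_left (hmono hω) (by positivity : 0 ≤ 2 * M)
    dsimp only
    linarith
  · have h2 := abs_le.1 (hM ω)
    have := mul_nonneg (by positivity : 0 ≤ 2 * M) (hpos ω)
    dsimp only
    linarith
  · have := mul_nonneg (by positivity : 0 ≤ 2 * M) (hpos ω)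
    dsimp only
    linarith
  · funext ω
    simp only [Pi.sub_apply]
    ring

/-! ### Infinite-volume limits -/

theorem weightSum_sub : weightSum ζ lam Λ b (f - g) =
    weightSum ζ lam Λ b f - weightSum ζ lam Λ b g := by
  simp only [weightSum, Pi.sub_apply, mul_sub, Finset.sum_sub_distrib]

/-- For nonnegative increasing functions the net is antitone and bounded below by `0`. -/
theorem exists_tendsto_integral_one (ζ : ExtField d) (lam : ℝ) (hf : IsLocal f) :
    ∃ l, Tendsto (fun Λ => ∫ ω, f ω ∂(finiteGibbs ζ lam Λ fun _ => 1)) atTop (𝓝 l) := by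
  have mono {f : Config d → ℝ} (hf : Monotone f) (hf0 : ∀ ω, 0 ≤ f ω) :
      ∃ l, Tendsto (fun Λ => ∫ ω, f ω ∂(finiteGibbs ζ lam Λ fun _ => 1)) atTop (𝓝 l) :=
    ⟨_, tendsto_atTop_ciInf (fun _ _ h => integral_finiteGibbs_one_antitone hf hf0 h)
      ⟨0, by rintro _ ⟨Λ, rfl⟩; exact integral_nonneg hf0⟩⟩
  obtain ⟨f₁, f₂, hf₁, hf₂, h₁, h₂, rfl⟩ := hf.exists_eq_sub_monotone
  obtain ⟨l₁, hl₁⟩ := mono hf₁ h₁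
  obtain ⟨l₂, hl₂⟩ := mono hf₂ h₂
  refine ⟨l₁ - l₂, (hl₁.sub hl₂).congr fun Λ => ?_⟩
  simp only [integral_finiteGibbs, weightSum_sub, sub_div]

theorem integral_finiteGibbs_neg_one (ζ : ExtField d) (lam : ℝ) (Λ : Finset (Site d))
    (f : Config d → ℝ) : ∫ ω, f ω ∂(finiteGibbs ζ lam Λ fun _ => -1) =
      ∫ ω, f (-ω) ∂(finiteGibbs (-ζ) lam Λ fun _ => 1) := by
  rw [← integral_finiteGibbs_neg, neg_neg]
  rfl

theorem exists_tendsto_integral_neg_one (ζ : ExtField d) (lam : ℝ) (hf : IsLocal f) :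
    ∃ l, Tendsto (fun Λ => ∫ ω, f ω ∂(finiteGibbs ζ lam Λ fun _ => -1)) atTop (𝓝 l) := by
  simp only [integral_finiteGibbs_neg_one]
  exact exists_tendsto_integral_one (-ζ) lam hf.comp_neg

instance : BorelSpace SignType := ⟨borel_eq_top_of_discrete.symm⟩

/-- Probability measures on the compact space `Config d` form a compact space, so an ultrafilter
finer than `atTop` yields a limit point. Its local integrals must be the limits of the convergent
nets, which every exhausting sequence inherits. -/
theorem exists_isInfiniteVolumeLimit (hb : Compatible b) (h : ∀ f : Config d → ℝ, IsLocal f →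
      ∃ l, Tendsto (fun Λ => ∫ ω, f ω ∂(finiteGibbs ζ lam Λ b)) atTop (𝓝 l)) :
    ∃ ν, IsInfiniteVolumeLimit ζ lam b ν := by
  let m : Finset (Site d) → ProbabilityMeasure (Config d) := fun Λ =>
    ⟨finiteGibbs ζ lam Λ b, isProbabilityMeasure_finiteGibbs hb ζ lam Λ⟩
  let U : Ultrafilter (Finset (Site d)) := Ultrafilter.of atTop
  obtain ⟨ν, -, hν⟩ := isCompact_univ.ultrafilter_le_nhds (U.map m) (by simp)
  have hν : Tendsto m U (𝓝 ν) := hν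
  rw [ProbabilityMeasure.tendsto_iff_forall_integral_tendsto] at hν
  refine ⟨ν, inferInstance, fun Λ hΛ hex f hf => ?_⟩
  obtain ⟨l, hl⟩ := h f hf
  have hU : Tendsto (fun Λ => ∫ ω, f ω ∂(finiteGibbs ζ lam Λ b)) U
      (𝓝 (∫ ω, f ω ∂(ν : Measure (Config d)))) :=
    hν (BoundedContinuousFunction.mkOfCompact ⟨f, hf.continuous⟩)
  rw [tendsto_nhds_unique hU (hl.mono_left (Ultrafilter.of_le _))]
  exact hl.comp (tendsto_atTop_finset_of_monotone hΛ hex)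

theorem isInfiniteVolumeLimit_plusState (ζ : ExtField d) (lam : ℝ) :
    IsInfiniteVolumeLimit ζ lam (fun _ => 1) (plusState ζ lam) := by
  have h := exists_isInfiniteVolumeLimit compatible_one fun f hf =>
    exists_tendsto_integral_one ζ lam hf
  rw [plusState, infiniteVolumeState, dif_pos h]
  exact h.choose_spec

theorem isInfiniteVolumeLimit_minusState (ζ : ExtField d) (lam : ℝ) :
    IsInfiniteVolumeLimit ζ lam (fun _ => -1) (minusState ζ lam) := by
  have h := exists_isInfiniteVolumeLimit compatible_neg_one fun f hf =>
    exists_tendsto_integral_neg_one ζ lam hf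
  rw [minusState, infiniteVolumeState, dif_pos h]
  exact h.choose_spec

/-- The cubes `[-n, n]^d`. -/
def box (d n : ℕ) : Finset (Site d) := Finset.Icc (fun _ => -(n : ℤ)) fun _ => (n : ℤ)

theorem box_mono (d : ℕ) : Monotone (box d) := fun m n h => by
  have : (m : ℤ) ≤ n := by exact_mod_cast h
  exact Finset.Icc_subset_Icc (fun _ => by simpa using h) fun _ => this

theorem exists_mem_box (x : Site d) : ∃ n, x ∈ box d n := by
  refine ⟨∑ i, (x i).natAbs, Finset.mem_Icc.2 ⟨fun i => ?_, fun i => ?_⟩⟩ <;>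
  · have := Finset.single_le_sum (f := fun i => (x i).natAbs) (fun _ _ => Nat.zero_le _)
      (Finset.mem_univ i)
    dsimp only at this ⊢
    omega

theorem tendsto_box (d : ℕ) : Tendsto (box d) atTop atTop :=
  tendsto_atTop_finset_of_monotone (box_mono d) exists_mem_box

theorem IsInfiniteVolumeLimit.tendsto_box {ν : Measure (Config d)}
    (hν : IsInfiniteVolumeLimit ζ lam b ν) (hf : IsLocal f) :
    Tendsto (fun n => ∫ ω, f ω ∂(finiteGibbs ζ lam (box d n) b)) atTop (𝓝 (∫ ω, f ω ∂ν)) :=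
  hν.2 _ (box_mono d) exists_mem_box f hf

theorem integral_minusState_neg (ζ : ExtField d) (lam : ℝ) (hf : IsLocal f) :
    ∫ ω, f ω ∂(minusState ζ lam) = ∫ ω, f (-ω) ∂(plusState (-ζ) lam) := by
  refine tendsto_nhds_unique ((isInfiniteVolumeLimit_minusState ζ lam).tendsto_box hf) ?_
  simp only [integral_finiteGibbs_neg_one]
  exact (isInfiniteVolumeLimit_plusState (-ζ) lam).tendsto_box hf.comp_neg

end WidomRowlinson

end

noncomputable section

namespace WidomRowlinson

variable {d : ℕ} {ζ ξ : ExtField d} {lam : ℝ} {Λ Δ B : Finset (Site d)} {b b' : Config d}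
  {f g : Config d → ℝ} {ν ν' : Measure (Config d)}

/-! ### Emptying a set of sites -/

open Classical in
/-- The indicator function of the event that all sites of `B` are empty. -/
def vacant (B : Finset (Site d)) (ω : Config d) : ℝ := if ∀ x ∈ B, ω x = 0 then 1 else 0

/-- The configuration `ω` with all particles in `B` removed. -/
def clear (B : Finset (Site d)) (ω : Config d) : Config d := fun x => if x ∈ B then 0 else ω x

theorem vacant_nonneg (B : Finset (Site d)) (ω : Config d) : 0 ≤ vacant B ω := by
  unfold vacant; split_ifs <;> norm_num

theorem vacant_le_one (B : Finset (Site d)) (ω : Config d) : vacant B ω ≤ 1 := by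
  unfold vacant; split_ifs <;> norm_num

theorem vacant_congr {ω ω' : Config d} (h : ∀ x ∈ B, ω x = ω' x) : vacant B ω = vacant B ω' := by
  unfold vacant
  congr 1
  exact propext (forall₂_congr fun x hx => by rw [h x hx])

theorem vacant_neg (B : Finset (Site d)) (ω : Config d) : vacant B (-ω) = vacant B ω := by
  unfold vacant
  congr 1
  exact propext (forall₂_congr fun x hx => by
    rw [Pi.neg_apply]
    generalize ω x = s
    revert s; decide)

theorem isLocal_vacant (B : Finset (Site d)) : IsLocal (vacant B) :=
  ⟨B, fun _ _ h => vacant_congr fun x hx => h x hx⟩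

theorem IsLocal.mul (hf : IsLocal f) (hg : IsLocal g) : IsLocal (f * g) := by
  classical
  obtain ⟨Δ, hΔ⟩ := hf
  obtain ⟨Δ', hΔ'⟩ := hg
  refine ⟨Δ ∪ Δ', fun ω ω' h => ?_⟩
  rw [Pi.mul_apply, Pi.mul_apply, hΔ fun x hx => h x (by simp [Finset.mem_coe.1 hx]),
    hΔ' fun x hx => h x (by simp [Finset.mem_coe.1 hx])]

theorem vacant_clear (B : Finset (Site d)) (ω : Config d) : vacant B (clear B ω) = 1 :=
  if_pos fun x hx => by simp [clear, hx]

theorem site_energy_le (lam z : ℝ) (s : SignType) :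
    lam * (s : ℝ) ^ 2 + z * s ≤ |lam| + |z| := by
  have := le_abs_self lam
  have := le_abs_self z
  have := neg_abs_le z
  have := abs_nonneg lam
  have := abs_nonneg z
  cases s <;> simp <;> linarith

/-- Removing particles cannot create a conflict, and an emptied site has energy zero. -/
theorem weight_le_weight_clear (hB : B ⊆ Δ) (ξ : ExtField d) (lam : ℝ) (ω : Config d) :
    weight ξ lam Δ ω ≤ Real.exp (∑ x ∈ B, (|lam| + |ξ x|)) * weight ξ lam Δ (clear B ω) := by
  by_cases h : Conflict Δ ω
  · rw [weight, if_pos h]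
    exact mul_nonneg (Real.exp_pos _).le (weight_nonneg ..)
  · have h' : ¬ Conflict Δ (clear B ω) := by
      rintro ⟨x, hx, y, hxy, e⟩
      refine h ⟨x, hx, y, hxy, ?_⟩
      simp only [clear] at e
      split_ifs at e <;> simp_all
    rw [weight, if_neg h, weight, if_neg h', ← Real.exp_add]
    refine Real.exp_le_exp.2 ?_
    rw [← Finset.sum_sdiff hB, ← Finset.sum_sdiff (f := fun x => lam * (clear B ω x : ℝ) ^ 2 +
      ξ x * (clear B ω x : ℝ)) hB]
    have h1 : ∑ x ∈ Δ \ B, (lam * (clear B ω x : ℝ) ^ 2 + ξ x * (clear B ω x : ℝ)) =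
        ∑ x ∈ Δ \ B, (lam * (ω x : ℝ) ^ 2 + ξ x * (ω x : ℝ)) :=
      Finset.sum_congr rfl fun x hx => by simp [clear, (Finset.mem_sdiff.1 hx).2]
    have h2 : ∑ x ∈ B, (lam * (clear B ω x : ℝ) ^ 2 + ξ x * (clear B ω x : ℝ)) = 0 :=
      Finset.sum_eq_zero fun x hx => by simp [clear, hx]
    have h3 : ∑ x ∈ B, (lam * (ω x : ℝ) ^ 2 + ξ x * (ω x : ℝ)) ≤ ∑ x ∈ B, (|lam| + |ξ x|) :=
      Finset.sum_le_sum fun x _ => site_energy_le ..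
    linarith

/-- A configuration is recovered from its cleared version and its spins in `B`, so fibres have at
most `3 ^ B.card` elements. This is the source of `Real.log 3`. -/
theorem sum_comp_clear_le (hB : B ⊆ Δ) {G : Config d → ℝ} (hG : ∀ ω, 0 ≤ G ω) :
    ∑ ω ∈ configs Δ b, G (clear B ω) ≤ 3 ^ B.card * ∑ ω ∈ configs Δ b, G ω := by
  classical
  have hmaps : ∀ ω ∈ configs Δ b, clear B ω ∈ configs Δ b := fun ω hω =>
    mem_configs.2 fun x hx => by
      simp [clear, show x ∉ B from fun h => hx (hB h), mem_configs.1 hω x hx]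
  rw [← Finset.sum_fiberwise_of_maps_to hmaps, Finset.mul_sum]
  refine Finset.sum_le_sum fun ω' _ => ?_
  rw [Finset.sum_congr rfl fun ω hω => by rw [(Finset.mem_filter.1 hω).2], Finset.sum_const,
    nsmul_eq_mul]
  refine mul_le_mul_of_nonneg_right ?_ (hG _)
  have hcard : ((configs Δ b).filter fun ω => clear B ω = ω').card ≤
      (Finset.univ : Finset (B → SignType)).card := by
    refine Finset.card_le_card_of_injOn (fun ω x => ω x) (fun _ _ => Finset.mem_univ _) ?_
    intro ω₁ h₁ ω₂ h₂ h
    have h₁ := (Finset.mem_filter.1 h₁).2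
    have h₂ := (Finset.mem_filter.1 h₂).2
    funext x
    by_cases hx : x ∈ B
    · exact congrFun h ⟨x, hx⟩
    · have := congrFun (h₁.trans h₂.symm) x
      simpa [clear, hx] using this
  have h3 : Fintype.card SignType = 3 := rfl
  rw [Finset.card_univ, Fintype.card_fun, h3, Fintype.card_coe] at hcard
  exact_mod_cast hcard

/-- The cost of removing the particles in `B`. -/
def clearCost (ξ : ExtField d) (lam : ℝ) (B : Finset (Site d)) : ℝ :=
  ∑ x ∈ B, (Real.log 3 + |lam| + |ξ x|)

theorem exp_clearCost (ξ : ExtField d) (lam : ℝ) (B : Finset (Site d)) :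
    Real.exp (clearCost ξ lam B) = Real.exp (∑ x ∈ B, (|lam| + |ξ x|)) * 3 ^ B.card := by
  simp only [clearCost, add_assoc]
  rw [Finset.sum_add_distrib, Real.exp_add, Finset.sum_const, nsmul_eq_mul, Real.exp_nat_mul,
    Real.exp_log (by norm_num), mul_comm]

theorem weightSum_le_vacant (hB : B ⊆ Δ) (hΛB : Disjoint Λ B) (hf : DependsOn f (Λ : Set (Site d)))
    (hf0 : ∀ ω, 0 ≤ f ω) :
    weightSum ξ lam Δ b f ≤
      Real.exp (clearCost ξ lam B) * weightSum ξ lam Δ b (f * vacant B) := by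
  have hfc (ω : Config d) : f (clear B ω) = f ω := hf fun x hx => by
    simp [clear, Finset.disjoint_left.1 hΛB (Finset.mem_coe.1 hx)]
  rw [exp_clearCost, mul_assoc]
  calc weightSum ξ lam Δ b f
      ≤ ∑ ω ∈ configs Δ b, Real.exp (∑ x ∈ B, (|lam| + |ξ x|)) *
          (weight ξ lam Δ (clear B ω) * (f * vacant B) (clear B ω)) := by
        refine Finset.sum_le_sum fun ω _ => ?_
        rw [Pi.mul_apply, vacant_clear, mul_one, hfc, ← mul_assoc]
        exact mul_le_mul_of_nonneg_right (weight_le_weight_clear hB ..) (hf0 _)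
    _ ≤ _ := by
        rw [← Finset.mul_sum]
        refine mul_le_mul_of_nonneg_left ?_ (Real.exp_pos _).le
        exact sum_comp_clear_le (G := fun ω => weight ξ lam Δ ω * (f * vacant B) ω) hB fun ω =>
          mul_nonneg (weight_nonneg ..) (mul_nonneg (hf0 _) (vacant_nonneg ..))

/-! ### Exchanging the configurations inside of `Λ` -/

/-- The configuration equal to `ω` in `Λ` and to `ω'` outside of `Λ`. -/
def merge (Λ : Finset (Site d)) (ω ω' : Config d) : Config d :=
  fun x => if x ∈ Λ then ω x else ω' x

/-- `B` separates `Λ` from its complement. -/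
def Separates (B Λ : Finset (Site d)) : Prop :=
  Disjoint Λ B ∧ ∀ x ∈ Λ, ∀ y ∉ Λ, Nbr x y → y ∈ B

/-- In a neighbouring pair straddling the border of `Λ`, the outer site lies in `B` and is empty, so
a conflict lies wholly in `ω` or wholly in `ω'`. -/
theorem conflict_or_of_conflict_merge (hs : Separates B Λ) {ω ω' : Config d}
    (hω' : ∀ x ∈ B, ω' x = 0) (h : Conflict Δ (merge Λ ω ω')) :
    Conflict Δ ω ∨ Conflict Δ ω' := by
  obtain ⟨x, hx, y, hxy, e⟩ := h
  simp only [merge] at e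
  split_ifs at e with h1 h2 h2
  · exact Or.inl ⟨x, hx, y, hxy, e⟩
  · rw [hω' y (hs.2 x h1 y h2 hxy)] at e
    simp at e
  · rw [hω' x (hs.2 y h2 x h1 hxy.symm)] at e
    simp at e
  · exact Or.inr ⟨x, hx, y, hxy, e⟩

theorem merge_merge (Λ : Finset (Site d)) (ω ω' : Config d) :
    merge Λ (merge Λ ω ω') (merge Λ ω' ω) = ω := by
  funext x
  by_cases h : x ∈ Λ <;> simp [merge, h]

theorem weight_mul_weight_le_merge (hs : Separates B Λ) {ω ω' : Config d}
    (hω : ∀ x ∈ B, ω x = 0) (hω' : ∀ x ∈ B, ω' x = 0) :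
    weight ξ lam Δ ω * weight ξ lam Δ ω' ≤
      weight ξ lam Δ (merge Λ ω' ω) * weight ξ lam Δ (merge Λ ω ω') := by
  by_cases h : Conflict Δ ω ∨ Conflict Δ ω'
  · have : weight ξ lam Δ ω * weight ξ lam Δ ω' = 0 := by
      rcases h with h | h <;> simp [weight, h]
    rw [this]
    exact mul_nonneg (weight_nonneg ..) (weight_nonneg ..)
  · have h1 := mt (conflict_or_of_conflict_merge hs hω') h
    have h2 := mt (conflict_or_of_conflict_merge hs hω) fun h' => h h'.symm
    rw [not_or] at h
    simp only [weight, h.1, h.2, h1, h2, if_false, ← Real.exp_add, ← Finset.sum_add_distrib]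
    refine (congrArg _ (Finset.sum_congr rfl fun x _ => ?_)).le
    by_cases hx : x ∈ Λ
    · simp only [merge, hx, if_true]
      ring
    · simp only [merge, hx, if_false]

theorem weight_mul_weight_eq_merge (hs : Separates B Λ) {ω ω' : Config d}
    (hω : ∀ x ∈ B, ω x = 0) (hω' : ∀ x ∈ B, ω' x = 0) :
    weight ξ lam Δ ω * weight ξ lam Δ ω' =
      weight ξ lam Δ (merge Λ ω' ω) * weight ξ lam Δ (merge Λ ω ω') := by
  refine (weight_mul_weight_le_merge hs hω hω').antisymm ?_
  -- The exchange is an involution, so the inequality for the exchanged pair is the reverse one.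
  have := weight_mul_weight_le_merge (ξ := ξ) (lam := lam) (Δ := Δ) hs (ω := merge Λ ω' ω)
    (ω' := merge Λ ω ω') (fun x hx => ?_) fun x hx => ?_
  · rwa [merge_merge, merge_merge] at this
  · simp [merge, Finset.disjoint_right.1 hs.1 hx, hω x hx]
  · simp [merge, Finset.disjoint_right.1 hs.1 hx, hω' x hx]

theorem merge_mem_configs (h : Λ ⊆ Δ) {ω : Config d} (ω' : Config d) (hω : ω ∈ configs Δ b) :
    merge Λ ω' ω ∈ configs Δ b :=
  mem_configs.2 fun x hx => by
    simp [merge, show x ∉ Λ from fun h' => hx (h h'), mem_configs.1 hω x hx]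

/-- Given that the boundary of `Λ` is empty, the expectation of a function of the configuration
in `Λ` does not depend on the boundary condition. -/
theorem weightSum_vacant_mul (hs : Separates B Λ) (h : Λ ⊆ Δ)
    (hf : DependsOn f (Λ : Set (Site d))) :
    weightSum ξ lam Δ b (f * vacant B) * weightSum ξ lam Δ b' (vacant B) =
      weightSum ξ lam Δ b (vacant B) * weightSum ξ lam Δ b' (f * vacant B) := by
  have hv (ω ω' : Config d) : vacant B (merge Λ ω' ω) = vacant B ω :=
    vacant_congr fun x hx => by simp [merge, Finset.disjoint_right.1 hs.1 hx]
  simp only [weightSum, Finset.sum_mul_sum, ← Finset.sum_product']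
  -- Exchanging the insides of `Λ` in a pair moves the factor `f` from the first component to the
  -- second. Pairs that are not both empty on `B` contribute zero on both sides.
  refine Finset.sum_nbij' (fun p => (merge Λ p.2 p.1, merge Λ p.1 p.2))
    (fun p => (merge Λ p.2 p.1, merge Λ p.1 p.2)) ?_ ?_ ?_ ?_ ?_
  · intro p hp
    rw [Finset.mem_product] at hp ⊢
    exact ⟨merge_mem_configs h _ hp.1, merge_mem_configs h _ hp.2⟩
  · intro p hp
    rw [Finset.mem_product] at hp ⊢
    exact ⟨merge_mem_configs h _ hp.1, merge_mem_configs h _ hp.2⟩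
  · intro p _
    simp only [merge_merge]
  · intro p _
    simp only [merge_merge]
  · intro p _
    have hfm : f (merge Λ p.1 p.2) = f p.1 := hf fun x hx => by
      simp [merge, Finset.mem_coe.1 hx]
    simp only [Pi.mul_apply, hv, hfm]
    by_cases h1 : ∀ x ∈ B, p.1 x = 0
    · by_cases h2 : ∀ x ∈ B, p.2 x = 0
      · linear_combination f p.1 * vacant B p.1 * vacant B p.2 *
          weight_mul_weight_eq_merge (ξ := ξ) (lam := lam) (Δ := Δ) hs h1 h2
      · simp [vacant, h2]
    · simp [vacant, h1]

/-! ### Passing to the infinite volume -/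

theorem IsInfiniteVolumeLimit.integral_le_vacant (hν : IsInfiniteVolumeLimit ξ lam b ν)
    (hΛB : Disjoint Λ B) (hf : DependsOn f (Λ : Set (Site d))) (hf0 : ∀ ω, 0 ≤ f ω) :
    ∫ ω, f ω ∂ν ≤ Real.exp (clearCost ξ lam B) * ∫ ω, (f * vacant B) ω ∂ν := by
  have hfl : IsLocal f := ⟨Λ, hf⟩
  refine le_of_tendsto_of_tendsto (hν.tendsto_box hfl)
    ((hν.tendsto_box (hfl.mul (isLocal_vacant B))).const_mul _) ?_
  filter_upwards [(WidomRowlinson.tendsto_box d).eventually_ge_atTop B] with n hn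
  rw [integral_finiteGibbs, integral_finiteGibbs, ← mul_div_assoc]
  exact div_le_div_of_nonneg_right (weightSum_le_vacant hn hΛB hf hf0)
    (weightSum_nonneg fun _ => zero_le_one)

theorem IsInfiniteVolumeLimit.integral_vacant_le (hν : IsInfiniteVolumeLimit ξ lam b ν)
    (hf : IsLocal f) (hf0 : ∀ ω, 0 ≤ f ω) :
    ∫ ω, (f * vacant B) ω ∂ν ≤ ∫ ω, f ω ∂ν := by
  refine le_of_tendsto_of_tendsto' (hν.tendsto_box (hf.mul (isLocal_vacant B)))
    (hν.tendsto_box hf) fun n => ?_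
  rw [integral_finiteGibbs, integral_finiteGibbs]
  exact div_le_div_of_nonneg_right (weightSum_mono fun ω =>
    mul_le_of_le_one_right (hf0 ω) (vacant_le_one ..)) (weightSum_nonneg fun _ => zero_le_one)

theorem IsInfiniteVolumeLimit.integral_vacant_mul (hν : IsInfiniteVolumeLimit ξ lam b ν)
    (hν' : IsInfiniteVolumeLimit ξ lam b' ν') (hs : Separates B Λ)
    (hf : DependsOn f (Λ : Set (Site d))) :
    (∫ ω, (f * vacant B) ω ∂ν) * ∫ ω, vacant B ω ∂ν' =
      (∫ ω, vacant B ω ∂ν) * ∫ ω, (f * vacant B) ω ∂ν' := by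
  have hv := isLocal_vacant B
  have hfl : IsLocal (f * vacant B) := IsLocal.mul ⟨Λ, hf⟩ hv
  refine tendsto_nhds_unique_of_eventuallyEq ((hν.tendsto_box hfl).mul (hν'.tendsto_box hv))
    ((hν.tendsto_box hv).mul (hν'.tendsto_box hfl)) ?_
  filter_upwards [(WidomRowlinson.tendsto_box d).eventually_ge_atTop Λ] with n hn
  simp only [integral_finiteGibbs, div_mul_div_comm, weightSum_vacant_mul hs hn hf]

theorem IsInfiniteVolumeLimit.integral_vacant_pos (hν : IsInfiniteVolumeLimit ξ lam b ν)
    (hΛB : Disjoint Λ B) (hf : DependsOn f (Λ : Set (Site d))) (hf0 : ∀ ω, 0 < f ω) :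
    0 < ∫ ω, (f * vacant B) ω ∂ν := by
  have := hν.1
  obtain ⟨M, hM⟩ := IsLocal.exists_abs_le ⟨Λ, hf⟩
  have hfl : IsLocal f := ⟨Λ, hf⟩
  have hpos : 0 < ∫ ω, f ω ∂ν := by
    rw [integral_pos_iff_support_of_nonneg (fun ω => (hf0 ω).le)]
    · rw [show Function.support f = Set.univ from Set.eq_univ_of_forall fun ω => (hf0 ω).ne',
        measure_univ]
      exact zero_lt_one
    · exact Integrable.of_bound hfl.continuous.aestronglyMeasurable M (ae_of_all _ hM)
  exact pos_of_mul_pos_right (hpos.trans_le (hν.integral_le_vacant hΛB hf fun ω => (hf0 ω).le))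
    (Real.exp_pos _).le

theorem IsInfiniteVolumeLimit.log_vacant_mem (hν : IsInfiniteVolumeLimit ξ lam b ν)
    (hΛB : Disjoint Λ B) (hf : DependsOn f (Λ : Set (Site d))) (hf0 : ∀ ω, 0 < f ω) :
    Real.log (∫ ω, (f * vacant B) ω ∂ν) ≤ Real.log (∫ ω, f ω ∂ν) ∧
      Real.log (∫ ω, f ω ∂ν) ≤ clearCost ξ lam B + Real.log (∫ ω, (f * vacant B) ω ∂ν) := by
  have h0 := hν.integral_vacant_pos hΛB hf hf0
  have h1 := hν.integral_vacant_le (B := B) ⟨Λ, hf⟩ fun ω => (hf0 ω).le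
  have h2 := hν.integral_le_vacant hΛB hf fun ω => (hf0 ω).le
  refine ⟨Real.log_le_log h0 h1, (Real.log_le_log (h0.trans_le h1) h2).trans_eq ?_⟩
  rw [Real.log_mul (Real.exp_pos _).ne' h0.ne', Real.log_exp]

theorem IsInfiniteVolumeLimit.integral_vacant_pos' (hν : IsInfiniteVolumeLimit ξ lam b ν) :
    0 < ∫ ω, vacant B ω ∂ν := by
  simpa using hν.integral_vacant_pos (Λ := ∅) (B := B) (f := 1) (by simp) (fun _ _ _ => rfl)
    fun _ => zero_lt_one

/-- The case `Λ = ∅`, `f = 1` of the emptying estimate. It makes the log-probabilities of an empty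
boundary integrable in the random field. -/
theorem IsInfiniteVolumeLimit.abs_log_vacant_le (hν : IsInfiniteVolumeLimit ξ lam b ν) :
    |Real.log (∫ ω, vacant B ω ∂ν)| ≤ clearCost ξ lam B := by
  have := hν.1
  have h := hν.log_vacant_mem (Λ := ∅) (B := B) (f := 1) (by simp) (fun _ _ _ => rfl)
    fun _ => zero_lt_one
  simp at h
  rw [abs_le]
  constructor <;> linarith [h.1, h.2]

/-- The logarithmic moments of two infinite-volume limits differ by at most the cost of emptying
the boundary, up to the logarithmic probabilities of an empty boundary. -/
theorem IsInfiniteVolumeLimit.abs_log_sub_log_le (hν : IsInfiniteVolumeLimit ξ lam b ν)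
    (hν' : IsInfiniteVolumeLimit ξ lam b' ν') (hs : Separates B Λ)
    (hf : DependsOn f (Λ : Set (Site d))) (hf0 : ∀ ω, 0 < f ω) :
    |(Real.log (∫ ω, f ω ∂ν) - Real.log (∫ ω, f ω ∂ν')) -
      (Real.log (∫ ω, vacant B ω ∂ν) - Real.log (∫ ω, vacant B ω ∂ν'))| ≤
        clearCost ξ lam B := by
  have h := hν.log_vacant_mem hs.1 hf hf0
  have h' := hν'.log_vacant_mem hs.1 hf hf0
  have e := congrArg Real.log (hν.integral_vacant_mul hν' hs hf)
  rw [Real.log_mul (hν.integral_vacant_pos hs.1 hf hf0).ne' hν'.integral_vacant_pos'.ne',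
    Real.log_mul hν.integral_vacant_pos'.ne' (hν'.integral_vacant_pos hs.1 hf hf0).ne'] at e
  -- Each logarithmic moment exceeds its version restricted to empty `B` by an amount in `[0,
  -- clearCost]`, and `e` relates the restricted versions. Two such errors differ by at most one
  -- `clearCost`, not two.
  rw [abs_le]
  constructor <;> linarith [h.1, h.2, h'.1, h'.2]

end WidomRowlinson

end

noncomputable section

namespace WidomRowlinson

variable {d : ℕ} {lam : ℝ} {Λ B : Finset (Site d)} {f : Config d → ℝ}
  {Ψ : Type*} [MeasurableSpace Ψ] {P : Measure Ψ} {η : Site d → Ψ → ℝ}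

/-! ### The boundary of a finite set -/

/-- Finiteness is what makes `Set.ncard` count the boundary, rather than take the default value `0`.
-/
theorem finite_outerBoundary (Λ : Finset (Site d)) :
    (outerBoundary (Λ : Set (Site d))).Finite := by
  refine Set.Finite.subset (Λ.finite_toSet.biUnion fun i _ =>
    Set.finite_Icc (fun k => i k - 1) fun k => i k + 1) ?_
  rintro j ⟨-, i, hi, hij⟩
  refine Set.mem_biUnion hi ?_
  have (k : Fin d) : |j k - i k| ≤ 1 := hij ▸
    Finset.single_le_sum (f := fun k => |j k - i k|) (fun _ _ => abs_nonneg _) (Finset.mem_univ k)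
  exact ⟨fun k => by have := abs_le.1 (this k); dsimp only; omega,
    fun k => by have := abs_le.1 (this k); dsimp only; omega⟩

theorem separates_outerBoundary (Λ : Finset (Site d)) :
    Separates (finite_outerBoundary Λ).toFinset Λ := by
  refine ⟨Finset.disjoint_left.2 fun x hx h => ?_, fun x hx y hy h => ?_⟩
  · exact ((finite_outerBoundary Λ).mem_toFinset.1 h).1 hx
  · exact (finite_outerBoundary Λ).mem_toFinset.2 ⟨hy, x, hx, h.symm⟩

/-! ### Measurability in the field -/

theorem measurable_weight (lam : ℝ) (Λ : Finset (Site d)) (ω : Config d) :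
    Measurable fun ξ : ExtField d => weight ξ lam Λ ω := by
  unfold weight
  split_ifs
  · exact measurable_const
  · fun_prop

theorem measurable_weightSum (lam : ℝ) (Λ : Finset (Site d)) (b : Config d) (f : Config d → ℝ) :
    Measurable fun ξ : ExtField d => weightSum ξ lam Λ b f :=
  Finset.measurable_sum _ fun ω _ => (measurable_weight lam Λ ω).mul_const _

/-- The states are merely chosen for each field, but their local integrals are pointwise limits of
ratios of finite sums that are measurable in the field. -/
theorem measurable_integral_of_isInfiniteVolumeLimit {b : Config d}
    {ν : ExtField d → Measure (Config d)} (hν : ∀ ξ, IsInfiniteVolumeLimit ξ lam b (ν ξ))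
    (hf : IsLocal f) : Measurable fun ξ => ∫ ω, f ω ∂(ν ξ) := by
  refine measurable_of_tendsto_metrizable
    (f := fun n ξ => ∫ ω, f ω ∂(finiteGibbs ξ lam (box d n) b)) (fun n => ?_)
    (tendsto_pi_nhds.2 fun ξ => (hν ξ).tendsto_box hf)
  simp only [integral_finiteGibbs]
  exact (measurable_weightSum ..).div (measurable_weightSum ..)

theorem measurable_zeroOn (Λ : Finset (Site d)) : Measurable (zeroOn Λ) := by
  refine measurable_pi_iff.2 fun x => ?_
  unfold zeroOn
  split_ifs <;> fun_prop

theorem measurable_log_plusState (lam : ℝ) (Λ : Finset (Site d)) (hf : IsLocal f) :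
    Measurable fun ξ => Real.log (∫ ω, f ω ∂(plusState (zeroOn Λ ξ) lam)) :=
  Real.measurable_log.comp ((measurable_integral_of_isInfiniteVolumeLimit
    (fun ξ => isInfiniteVolumeLimit_plusState ξ lam) hf).comp (measurable_zeroOn Λ))

theorem measurable_log_minusState (lam : ℝ) (Λ : Finset (Site d)) (hf : IsLocal f) :
    Measurable fun ξ => Real.log (∫ ω, f ω ∂(minusState (zeroOn Λ ξ) lam)) :=
  Real.measurable_log.comp ((measurable_integral_of_isInfiniteVolumeLimit
    (fun ξ => isInfiniteVolumeLimit_minusState ξ lam) hf).comp (measurable_zeroOn Λ))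

/-! ### Symmetric i.i.d. fields -/

namespace IsSymmetricIIDField

theorem measurable_field (hη : IsSymmetricIIDField P η) : Measurable fun ψ x => η x ψ :=
  measurable_pi_iff.2 hη.measurable

/-- The law of the field is invariant under a global change of sign. -/
theorem map_neg [IsProbabilityMeasure P] (hη : IsSymmetricIIDField P η) :
    P.map (fun ψ x => -η x ψ) = P.map fun ψ x => η x ψ := by
  have hn : iIndepFun (fun x ψ => -η x ψ) P :=
    hη.indep.comp (fun _ t => -t) fun _ => measurable_neg
  -- By independence both laws are product measures, so the one-site laws suffice.
  rw [hη.indep.map_fun_eq_infinitePi_map hη.measurable,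
    hn.map_fun_eq_infinitePi_map (X := fun x ψ => -η x ψ) fun x => (hη.measurable x).neg]
  congr 1
  funext x
  rw [(hη.identDistrib x).map_eq, hη.symm.map_eq]
  exact ((hη.identDistrib x).comp measurable_neg).map_eq

theorem integral_comp_neg [IsProbabilityMeasure P] (hη : IsSymmetricIIDField P η)
    {g : ExtField d → ℝ} (hg : Measurable g) :
    ∫ ψ, g (fun x => -η x ψ) ∂P = ∫ ψ, g (fun x => η x ψ) ∂P := by
  have hn : Measurable fun ψ x => -η x ψ := measurable_pi_iff.2 fun x => (hη.measurable x).neg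
  rw [← integral_map hn.aemeasurable hg.aestronglyMeasurable, hη.map_neg,
    integral_map hη.measurable_field.aemeasurable hg.aestronglyMeasurable]

theorem identDistrib_abs (hη : IsSymmetricIIDField P η) (x : Site d) :
    IdentDistrib (fun ψ => |η x ψ|) (fun ψ => |η 0 ψ|) P P :=
  (hη.identDistrib x).comp measurable_norm

theorem integrable_abs [IsProbabilityMeasure P] (hη : IsSymmetricIIDField P η) (x : Site d) :
    Integrable (fun ψ => |η x ψ|) P :=
  (hη.identDistrib_abs x).integrable_iff.2 (hη.memLp.integrable one_le_two).abs

theorem integrable_clearCost [IsProbabilityMeasure P] (hη : IsSymmetricIIDField P η) (lam : ℝ)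
    (B : Finset (Site d)) : Integrable (fun ψ => clearCost (fun x => η x ψ) lam B) P :=
  integrable_finsetSum _ fun x _ => (integrable_const _).add (hη.integrable_abs x)

theorem integral_clearCost [IsProbabilityMeasure P] (hη : IsSymmetricIIDField P η) (lam : ℝ)
    (B : Finset (Site d)) : ∫ ψ, clearCost (fun x => η x ψ) lam B ∂P =
      (Real.log 3 + |lam| + ∫ ψ, |η 0 ψ| ∂P) * B.card := by
  have hi (x : Site d) : Integrable (fun ψ => Real.log 3 + |lam| + |η x ψ|) P :=
    (integrable_const _).add (hη.integrable_abs x)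
  have hint (x : Site d) : ∫ ψ, (Real.log 3 + |lam| + |η x ψ|) ∂P =
      Real.log 3 + |lam| + ∫ ψ, |η 0 ψ| ∂P := by
    rw [integral_add (integrable_const _) (hη.integrable_abs x), (hη.identDistrib_abs x).integral_eq]
    simp
  simp only [clearCost]
  rw [integral_finsetSum _ fun x _ => hi x]
  rw [Finset.sum_congr rfl fun x _ => hint x, Finset.sum_const, nsmul_eq_mul, mul_comm]

end IsSymmetricIIDField

/-! ### The surface order estimate -/

theorem clearCost_zeroOn (h : Disjoint Λ B) (ξ : ExtField d) (lam : ℝ) :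
    clearCost (zeroOn Λ ξ) lam B = clearCost ξ lam B :=
  Finset.sum_congr rfl fun x hx => by simp [zeroOn, Finset.disjoint_right.1 h hx]

theorem zeroOn_neg (Λ : Finset (Site d)) (ξ : ExtField d) : zeroOn Λ (-ξ) = -zeroOn Λ ξ := by
  funext x
  by_cases h : x ∈ Λ <;> simp [zeroOn, h]

/-- Being empty is invariant under the spin flip. -/
theorem integral_vacant_minusState (ξ : ExtField d) (lam : ℝ) (Λ B : Finset (Site d)) :
    ∫ ω, vacant B ω ∂(minusState (zeroOn Λ ξ) lam) =
      ∫ ω, vacant B ω ∂(plusState (zeroOn Λ (-ξ)) lam) := by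
  rw [integral_minusState_neg _ _ (isLocal_vacant B), zeroOn_neg]
  simp only [vacant_neg]

theorem dependsOn_exp_sum (ζ : ExtField d) (Λ : Finset (Site d)) :
    DependsOn (fun ω : Config d => Real.exp (∑ x ∈ Λ, ζ x * (ω x : ℝ))) (Λ : Set (Site d)) :=
  fun _ _ h => congrArg Real.exp (Finset.sum_congr rfl fun x hx => by rw [h x hx])

theorem integrable_and_abs_genDiff_le [IsProbabilityMeasure P] (hη : IsSymmetricIIDField P η)
    (lam : ℝ) (ζ : ExtField d) (Λ : Finset (Site d)) :
    Integrable (fun ψ => genPlus lam Λ ζ (fun x => η x ψ) - genMinus lam Λ ζ (fun x => η x ψ)) P ∧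
      |genDiff P η lam Λ ζ| ≤ (Real.log 3 + |lam| + ∫ ψ, |η 0 ψ| ∂P) *
        ((outerBoundary (Λ : Set (Site d))).ncard : ℝ) := by
  set B := (finite_outerBoundary Λ).toFinset
  have hs : Separates B Λ := separates_outerBoundary Λ
  set vp : ExtField d → ℝ := fun ξ =>
    Real.log (∫ ω, vacant B ω ∂(plusState (zeroOn Λ ξ) lam)) with hvp
  set vm : ExtField d → ℝ := fun ξ =>
    Real.log (∫ ω, vacant B ω ∂(minusState (zeroOn Λ ξ) lam)) with hvm
  have hvpm : Measurable vp := measurable_log_plusState lam Λ (isLocal_vacant B)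
  have hvmm : Measurable vm := measurable_log_minusState lam Λ (isLocal_vacant B)
  have hf := dependsOn_exp_sum ζ Λ
  have hgm : Measurable fun ξ => genPlus lam Λ ζ ξ - genMinus lam Λ ζ ξ :=
    (measurable_log_plusState lam Λ ⟨Λ, hf⟩).sub (measurable_log_minusState lam Λ ⟨Λ, hf⟩)
  have hC := hη.integrable_clearCost lam B
  have hvpi : Integrable (fun ψ => vp fun x => η x ψ) P :=
    hC.mono' (hvpm.comp hη.measurable_field).aestronglyMeasurable <| ae_of_all _ fun ψ =>
      (isInfiniteVolumeLimit_plusState _ lam).abs_log_vacant_le.trans_eq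
        (clearCost_zeroOn hs.1 _ lam)
  have hvmi : Integrable (fun ψ => vm fun x => η x ψ) P :=
    hC.mono' (hvmm.comp hη.measurable_field).aestronglyMeasurable <| ae_of_all _ fun ψ =>
      (isInfiniteVolumeLimit_minusState _ lam).abs_log_vacant_le.trans_eq
        (clearCost_zeroOn hs.1 _ lam)
  have hbound (ξ : ExtField d) :
      |(genPlus lam Λ ζ ξ - genMinus lam Λ ζ ξ) - (vp ξ - vm ξ)| ≤ clearCost ξ lam B :=
    ((isInfiniteVolumeLimit_plusState (zeroOn Λ ξ) lam).abs_log_sub_log_le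
      (isInfiniteVolumeLimit_minusState (zeroOn Λ ξ) lam) hs hf
      fun _ => Real.exp_pos _).trans_eq (clearCost_zeroOn hs.1 _ lam)
  have hdiff : Integrable (fun ψ => (genPlus lam Λ ζ (fun x => η x ψ) -
      genMinus lam Λ ζ (fun x => η x ψ)) - (vp (fun x => η x ψ) - vm (fun x => η x ψ))) P :=
    hC.mono' ((hgm.sub (hvpm.sub hvmm)).comp hη.measurable_field).aestronglyMeasurable <|
      ae_of_all _ fun ψ => hbound _
  have hint : Integrable (fun ψ => genPlus lam Λ ζ (fun x => η x ψ) -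
      genMinus lam Λ ζ (fun x => η x ψ)) P :=
    (hdiff.add (hvpi.sub hvmi)).congr <| ae_of_all _ fun ψ => by simp
  refine ⟨hint, ?_⟩
  -- Pointwise, `vm ξ = vp (-ξ)`; the symmetry of the law of the field removes the sign.
  have hsymm : ∫ ψ, vm (fun x => η x ψ) ∂P = ∫ ψ, vp (fun x => η x ψ) ∂P := by
    rw [← hη.integral_comp_neg hvpm]
    simp only [hvm, hvp, integral_vacant_minusState]
    rfl
  have hv : Integrable (fun ψ => vp (fun x => η x ψ) - vm (fun x => η x ψ)) P := hvpi.sub hvmi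
  -- Subtracting `vp - vm`, whose mean is zero, leaves an integrand bounded pointwise by
  -- `clearCost`.
  have heq : genDiff P η lam Λ ζ = ∫ ψ, ((genPlus lam Λ ζ (fun x => η x ψ) -
      genMinus lam Λ ζ (fun x => η x ψ)) - (vp (fun x => η x ψ) - vm (fun x => η x ψ))) ∂P := by
    rw [integral_sub hint hv, integral_sub hvpi hvmi, hsymm, sub_self, sub_zero, genDiff]
  rw [heq, Set.ncard_eq_toFinset_card _ (finite_outerBoundary Λ), ← hη.integral_clearCost lam,
    ← Real.norm_eq_abs]
  refine norm_integral_le_of_norm_le hC (ae_of_all _ fun ψ => ?_)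
  exact hbound fun x => η x ψ

end WidomRowlinson

end

theorem mainTheorem6 {d : ℕ} (hd : 1 ≤ d) (lam : ℝ)
    {Ψ : Type*} [MeasurableSpace Ψ] (P : Measure Ψ) [IsProbabilityMeasure P]
    (η : WidomRowlinson.Site d → Ψ → ℝ) (hη : WidomRowlinson.IsSymmetricIIDField P η) :
    (∀ ξ : WidomRowlinson.ExtField d,
      WidomRowlinson.IsInfiniteVolumeLimit ξ lam (fun _ => 1) (WidomRowlinson.plusState ξ lam) ∧
      WidomRowlinson.IsInfiniteVolumeLimit ξ lam (fun _ => -1)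
        (WidomRowlinson.minusState ξ lam)) ∧
    ∀ (ζ : WidomRowlinson.ExtField d) (Λ : Finset (WidomRowlinson.Site d)),
      Integrable (fun ψ => WidomRowlinson.genPlus lam Λ ζ (fun x => η x ψ) -
        WidomRowlinson.genMinus lam Λ ζ (fun x => η x ψ)) P ∧
      |WidomRowlinson.genDiff P η lam Λ ζ| ≤
        (Real.log 3 + |lam| + ∫ ψ, |η 0 ψ| ∂P) *
          ((WidomRowlinson.outerBoundary (Λ : Set (WidomRowlinson.Site d))).ncard : ℝ) :=
  ⟨fun ξ => ⟨WidomRowlinson.isInfiniteVolumeLimit_plusState ξ lam,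
    WidomRowlinson.isInfiniteVolumeLimit_minusState ξ lam⟩,
    WidomRowlinson.integrable_and_abs_genDiff_le hη lam⟩
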